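/- **Corollary 3.1.** Let $t$ be a positive integer and put $t_0=0$ if $t$ is odd, $t_0=\tfrac12$ if $t$ is even. A *$V_t$-coding* is a vector $(v_0,\dots,v_{t-1})\in(t_0+\mathbb Z)^t$ with $v_0>v_1>\dots>v_{t-1}$ and $v_0+\dots+v_{t-1}=0$, whose entries represent all the classes $t_0+\{0,1,\dots,t-1\}$ modulo $t$. Let $\lambda$ be a $t$-core, i.e. a partition whose multiset $\mathcal H(\lambda)$ of hook lengths contains no multiple of $t$. Let $W(\lambda)=\{\lambda_i-i+\tfrac{t+1}{2} : i\ge 1\}$ (with $\lambda_i=0$ beyond the length of $\lambda$), and let $V(\lambda)$ be the set of those elements of $W(\lambda)$ that are the largest in their congruence class modulo $t$. Then the elements of $V(\lambda)$, listed in decreasing order, form a $V_t$-coding $\phi_t(\lambda)=(v_0,\dots,v_{t-1})$. Let $(u_0,\dots,u_{t-1})$ be its rearrangement with $u_i\equiv i+t_0\pmod t$ for $0\le i\le t-1$. Let $F$ be a field and let $\tau:\mathbb Z\to F$ be even ($\tau(-k)=\tau(k)$ for all $k$) or odd ($\tau(-k)=-\tau(k)$ for all $k$), with $\tau(h)\neq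 0$ for all $h\in\mathcal H(\lambda)$ and $\tau(k)\ne 0$ for $1\le k\le t-1$. Then $$\prod_{h\in\mathcal H(\lambda)}\frac{\tau(h-t)\,\tau(h+t)}{\tau(h)^2}=\frac{C}{\prod_{k=1}^{t-1}\tau(k)^{t-k}}\prod_{0\le i<j\le t-1}\tau(u_i-u_j),$$ where $C=-1$ if $t\equiv 3\pmod 4$ and $\tau$ is odd, and $C=1$ otherwise. -/

import Mathlib

namespace HookCoding

/-- The hook length of the cell `c = (i, j)` (row `i`, column `j`, counted from `0`) of `μ`:
arm length plus leg length plus one. It is used for cells of `μ` only, where no subtraction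
truncates. -/
def hookLength (μ : YoungDiagram) (c : ℕ × ℕ) : ℕ :=
  (μ.rowLen c.1 - c.2 - 1) + (μ.colLen c.2 - c.1 - 1) + 1

/-- The multiset `H(μ)` of all hook lengths of `μ`. -/
def hookLengths (μ : YoungDiagram) : Multiset ℕ :=
  μ.cells.val.map (hookLength μ)

/-- The multiset `H_t(μ)` of the hook lengths of `μ` that are multiples of `t`. -/
def hookLengthsMultiple (t : ℕ) (μ : YoungDiagram) : Multiset ℕ :=
  (hookLengths μ).filter (fun h => t ∣ h)

/-- `μ` is a `t`-core: no hook length is a multiple of `t`. -/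
def IsCore (t : ℕ) (μ : YoungDiagram) : Prop :=
  hookLengthsMultiple t μ = 0

/-- The shift `t₀`: it is `0` if `t` is odd and `1/2` if `t` is even. -/
def shift (t : ℕ) : ℚ :=
  if Odd t then 0 else 1 / 2

/-- The `W`-set of `μ`: all numbers `μ_i - i + (t + 1) / 2` with `i ≥ 1`, where `μ_i = 0` beyond the
length of `μ`. Here `i = n + 1`, and `μ.rowLen n` is the part `μ_{n + 1}`. -/
def wSet (t : ℕ) (μ : YoungDiagram) : Set ℚ :=
  {x | ∃ n : ℕ, x = (μ.rowLen n : ℚ) - ((n : ℚ) + 1) + ((t : ℚ) + 1) / 2}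

/-- The `V`-set of `μ`: the elements of the `W`-set that are the largest in their congruence class
modulo `t` within the `W`-set. -/
def vSet (t : ℕ) (μ : YoungDiagram) : Set ℚ :=
  {x | x ∈ wSet t μ ∧ ∀ y ∈ wSet t μ, y ≡ x [PMOD (t : ℚ)] → y ≤ x}

/-- `V_t`-codings: strictly decreasing vectors with entries in `t₀ + ℤ` that run through all the
residue classes `t₀ + r` modulo `t` (`0 ≤ r ≤ t - 1`) and sum to `0`. -/
structure IsCoding (t : ℕ) (v : Fin t → ℚ) : Prop where
  mem_shift : ∀ i, ∃ n : ℤ, v i = shift t + (n : ℚ)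
  residues : ∀ r : Fin t, ∃ i, v i ≡ ((r : ℕ) : ℚ) + shift t [PMOD (t : ℚ)]
  sum_eq_zero : ∑ i, v i = 0
  strictAnti : StrictAnti v

/-- `v` is the `V_t`-coding `φ_t(μ)` of `μ`: the coding that lists the `V`-set of `μ` in decreasing
order. For given `t` and `μ` there is at most one such `v`. -/
def IsCodingOf (t : ℕ) (μ : YoungDiagram) (v : Fin t → ℚ) : Prop :=
  IsCoding t v ∧ Set.range v = vSet t μ

/-- `u` is the rearrangement of `v` by congruence classes: `u_i ≡ i + t₀ (mod t)`. -/
def IsResidueSorting (t : ℕ) (v u : Fin t → ℚ) : Prop :=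
  (∃ σ : Equiv.Perm (Fin t), ∀ i, u i = v (σ i)) ∧
    ∀ i : Fin t, u i ≡ ((i : ℕ) : ℚ) + shift t [PMOD (t : ℚ)]

open Classical in
/-- The constant `C`: it is `-1` if `t ≡ 3 (mod 4)` and `τ` is odd, and `1` otherwise. -/
noncomputable def signConstant {F : Type*} [Field F] (t : ℕ) (τ : ℤ → F) : F :=
  if t % 4 = 3 ∧ Function.Odd τ then -1 else 1

/-- The differences of a vector sorted by congruence classes are integers, so taking their floor
only turns a rational number that is an integer into that element of `ℤ`. -/
theorem IsResidueSorting.floor_sub {t : ℕ} {v u : Fin t → ℚ} (h : IsResidueSorting t v u)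
    (i j : Fin t) : ((⌊u i - u j⌋ : ℤ) : ℚ) = u i - u j := by
  obtain ⟨a, ha⟩ := (AddCommGroup.modEq_iff_eq_add_zsmul).1 (h.2 i)
  obtain ⟨b, hb⟩ := (AddCommGroup.modEq_iff_eq_add_zsmul).1 (h.2 j)
  have key : u i - u j = (((i : ℕ) : ℤ) - ((j : ℕ) : ℤ) - (a - b) * (t : ℤ) : ℤ) := by
    simp only [zsmul_eq_mul] at ha hb
    push_cast
    linarith
  rw [key, Int.floor_intCast]

end HookCoding

/-! Let `X` be the set of beta numbers. Hooks of length `h` correspond to the `x ∈ X` with `x - h ∉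
X`; let `N(h)` be their number, for every integer `h`. For a `t`-core, `X` is stable under
subtraction of `t`, so the set `E` of `x ∈ X` with `x + t ∉ X` holds the largest element of each
class mod `t`; up to translation, `E` is the `V`-set.

Two facts give the identity: `N(k-t) + N(k+t) - 2N(k)` counts the `y ∈ E` with `y + k ∈ E`
(`ncard_leaving_add_ncard_leaving`), and `N(-h) = N(h) + h` (`IsNeutral.ncard_leaving_neg`), which
is the source of the factors `τ(k)^(t-k)`. Hence the multisets of all `|h - t|`, all `h + t`, and
each `k < t` taken `t - k` times make up two copies of the hook lengths together with all `|u_i -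
u_j|` (`hook_multiset_identity`).

For even `τ` this is the claim. For odd `τ` the signs of the `h - t` and `u_i - u_j` remain. They
come from the same identity, applied to `k ↦ (-1)^⌊k/t⌋` (`prod_unitSign_mul_prod_unitSign`). -/

namespace HookCoding

/-! ### Beta numbers, gaps and hook lengths -/

/-- The `n`-th beta number of `μ`, normalised so that the empty diagram has the beta numbers
`0, -1, -2, …`. -/
def beta (μ : YoungDiagram) (n : ℕ) : ℤ := μ.rowLen n - n

/-- The set of all beta numbers of `μ`. -/
def betaSet (μ : YoungDiagram) : Set ℤ := Set.range (beta μ)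

/-- The `j`-th integer that is not a beta number of `μ`. -/
def gap (μ : YoungDiagram) (j : ℕ) : ℤ := j + 1 - μ.colLen j

theorem lt_rowLen_iff_lt_colLen (μ : YoungDiagram) (i j : ℕ) :
    j < μ.rowLen i ↔ i < μ.colLen j := by
  rw [← YoungDiagram.mem_iff_lt_rowLen, YoungDiagram.mem_iff_lt_colLen]

theorem beta_strictAnti (μ : YoungDiagram) : StrictAnti (beta μ) := by
  intro a b hab
  have := μ.rowLen_anti a b hab.le
  unfold beta
  omega

theorem gap_lt_beta_iff (μ : YoungDiagram) (i j : ℕ) :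
    gap μ j < beta μ i ↔ j < μ.rowLen i := by
  have := lt_rowLen_iff_lt_colLen μ i j
  unfold gap beta
  omega

theorem gap_ne_beta (μ : YoungDiagram) (i j : ℕ) : gap μ j ≠ beta μ i := by
  have := lt_rowLen_iff_lt_colLen μ i j
  unfold gap beta
  omega

theorem gap_strictMono (μ : YoungDiagram) : StrictMono (gap μ) := by
  intro a b hab
  have := μ.colLen_anti a b hab.le
  unfold gap
  omega

theorem beta_of_colLen_le (μ : YoungDiagram) {n : ℕ} (hn : μ.colLen 0 ≤ n) :
    beta μ n = -n := by
  have := lt_rowLen_iff_lt_colLen μ n 0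
  unfold beta
  omega

/-- A value `y` strictly between `gap μ j` and `gap μ (j + 1)` forces row `j + 1 - y` to have length
exactly `j + 1`, so `y` is its beta number. Below `gap μ 0` lie only beta numbers of empty rows. -/
theorem notMem_betaSet_iff (μ : YoungDiagram) (y : ℤ) :
    y ∉ betaSet μ ↔ ∃ j, gap μ j = y := by
  constructor
  · intro hy
    have h0 : gap μ 0 ≤ y := by
      by_contra hlt
      refine hy ⟨(-y).toNat, ?_⟩
      unfold gap at hlt
      rw [beta_of_colLen_le μ (by omega)]
      omega
    have hbig : ∀ j, gap μ j ≤ y → j ≤ (y + μ.colLen 0).toNat := by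
      intro j hj
      have := μ.colLen_anti 0 j (Nat.zero_le _)
      unfold gap at hj
      omega
    classical
    set j := Nat.findGreatest (fun j => gap μ j ≤ y) (y + μ.colLen 0).toNat with hj
    have hjy : gap μ j ≤ y :=
      Nat.findGreatest_spec (P := fun j => gap μ j ≤ y) (Nat.zero_le _) h0
    have hjs : y < gap μ (j + 1) := by
      by_contra hle
      have := Nat.le_findGreatest (P := fun j => gap μ j ≤ y) (hbig _ (not_lt.1 hle))
        (not_lt.1 hle)
      omega
    refine ⟨j, le_antisymm hjy ?_⟩
    by_contra hlt
    refine hy ⟨(j + 1 - y).toNat, ?_⟩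
    have h1 := lt_rowLen_iff_lt_colLen μ (j + 1 - y).toNat j
    have h2 := lt_rowLen_iff_lt_colLen μ (j + 1 - y).toNat (j + 1)
    unfold gap at hjs hlt
    unfold beta
    push_cast at hjs
    omega
  · rintro ⟨j, rfl⟩ ⟨i, hi⟩
    exact gap_ne_beta μ i j hi.symm

theorem hookLength_eq_beta_sub_gap (μ : YoungDiagram) {i j : ℕ} (h : j < μ.rowLen i) :
    (hookLength μ (i, j) : ℤ) = beta μ i - gap μ j := by
  have := (lt_rowLen_iff_lt_colLen μ i j).1 h
  simp only [hookLength, beta, gap]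
  omega

/-- The elements of `X` that leave `X` when they are lowered by `h`. -/
def leaving (X : Set ℤ) (h : ℤ) : Set ℤ := {x | x ∈ X ∧ x - h ∉ X}

/-- The multiplicity of a hook length in terms of the beta numbers. -/
theorem count_hookLengths (μ : YoungDiagram) (h : ℕ) :
    (hookLengths μ).count h = (leaving (betaSet μ) h).ncard := by
  classical
  have himg : leaving (betaSet μ) h =
      ((μ.cells.filter fun c => h = hookLength μ c).image fun c => beta μ c.1 : Finset ℤ) := by
    ext x
    simp only [leaving, Set.mem_ofPred_eq, Finset.coe_image, Finset.coe_filter, Set.mem_image,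
      YoungDiagram.mem_cells, Prod.exists]
    constructor
    · rintro ⟨⟨i, rfl⟩, hy⟩
      obtain ⟨j, hj⟩ := (notMem_betaSet_iff μ _).1 hy
      have hne := gap_ne_beta μ i j
      have hij := (gap_lt_beta_iff μ i j).1 (by omega)
      refine ⟨i, j, ⟨YoungDiagram.mem_iff_lt_rowLen.2 hij, ?_⟩, rfl⟩
      have := hookLength_eq_beta_sub_gap μ hij
      omega
    · rintro ⟨i, j, ⟨hmem, hh⟩, rfl⟩
      refine ⟨⟨i, rfl⟩, (notMem_betaSet_iff μ _).2 ⟨j, ?_⟩⟩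
      have := hookLength_eq_beta_sub_gap μ (YoungDiagram.mem_iff_lt_rowLen.1 hmem)
      omega
  rw [himg, Set.ncard_coe_finset, Finset.card_image_of_injOn, hookLengths, Multiset.count_map]
  · rfl
  · rintro ⟨i, j⟩ hc ⟨i', j'⟩ hc' heq
    simp only [Finset.coe_filter, Set.mem_ofPred_eq, YoungDiagram.mem_cells,
      YoungDiagram.mem_iff_lt_rowLen] at hc hc'
    obtain rfl : i = i' := (beta_strictAnti μ).injective heq
    have h1 := hookLength_eq_beta_sub_gap μ hc.1
    have h2 := hookLength_eq_beta_sub_gap μ hc'.1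
    obtain rfl : j = j' := (gap_strictMono μ).injective (by omega)
    rfl

/-! ### Neutral sets of integers -/

/-- `X` contains all integers up to `-L` and, for every `M ≥ L`, exactly `M` integers
above `-M`. -/
structure IsNeutral (X : Set ℤ) (L : ℕ) : Prop where
  mem_of_le : ∀ x : ℤ, x ≤ -L → x ∈ X
  exists_finset : ∀ M : ℕ, L ≤ M →
    ∃ A : Finset ℤ, A.card = M ∧ ∀ x, x ∈ A ↔ x ∈ X ∧ -(M : ℤ) < x

theorem isNeutral_betaSet (μ : YoungDiagram) : IsNeutral (betaSet μ) (μ.colLen 0) where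
  mem_of_le x hx := ⟨(-x).toNat, by rw [beta_of_colLen_le μ (by omega)]; omega⟩
  exists_finset M hM := by
    refine ⟨(Finset.range M).image (beta μ), ?_, fun x => ?_⟩
    · rw [Finset.card_image_of_injective _ (beta_strictAnti μ).injective, Finset.card_range]
    · simp only [Finset.mem_image, Finset.mem_range, betaSet, Set.mem_range]
      constructor
      · rintro ⟨n, hn, rfl⟩
        refine ⟨⟨n, rfl⟩, ?_⟩
        unfold beta
        omega
      · rintro ⟨⟨n, rfl⟩, hx⟩
        refine ⟨n, ?_, rfl⟩
        by_contra hle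
        rw [beta_of_colLen_le μ (by omega)] at hx
        omega

namespace IsNeutral

variable {X : Set ℤ} {L : ℕ}

theorem finite_leaving (hX : IsNeutral X L) (h : ℤ) : (leaving X h).Finite := by
  obtain ⟨A, -, hA⟩ := hX.exists_finset (L + h.natAbs) (by omega)
  refine A.finite_toSet.subset fun x hx => (hA x).2 ⟨hx.1, ?_⟩
  by_contra hle
  exact hx.2 (hX.mem_of_le _ (by rw [Nat.cast_add] at hle; omega))

/-- The numbers of elements leaving `X` under opposite shifts differ by the shift. -/
theorem ncard_leaving_neg (hX : IsNeutral X L) (h : ℕ) :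
    (leaving X (-h)).ncard = (leaving X h).ncard + h := by
  classical
  obtain ⟨A, hAc, hA⟩ := hX.exists_finset (L + h) (by omega)
  obtain ⟨B, hBc, hB⟩ := hX.exists_finset L le_rfl
  -- `A` and `B'` are the parts of `X` and of `X - h` above the common bound `-(L + h)`. Below it
  -- both sets contain everything, so only `A \ B'` and `B' \ A` matter.
  set B' := B.map (Equiv.subRight (h : ℤ)).toEmbedding with hB'
  have hB'mem : ∀ x, x ∈ B' ↔ x + h ∈ X ∧ -((L + h : ℕ) : ℤ) < x := by
    intro x
    simp only [hB', Finset.mem_map_equiv, Equiv.subRight_symm_apply, hB]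
    push_cast
    constructor <;> rintro ⟨h1, h2⟩ <;> exact ⟨h1, by omega⟩
  have h1 : leaving X (-h) = ((A \ B' : Finset ℤ) : Set ℤ) := by
    ext x
    simp only [leaving, Set.mem_ofPred_eq, Finset.coe_sdiff, Set.mem_sdiff, Finset.mem_coe, hA,
      hB'mem, sub_neg_eq_add]
    constructor
    · rintro ⟨hx, hxh⟩
      refine ⟨⟨hx, ?_⟩, fun hc => hxh hc.1⟩
      by_contra hle
      exact hxh (hX.mem_of_le _ (by push_cast at hle; omega))
    · rintro ⟨⟨hx, hlt⟩, hn⟩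
      exact ⟨hx, fun hc => hn ⟨hc, hlt⟩⟩
  have h2 : leaving X h =
      (((B' \ A).map (Equiv.addRight (h : ℤ)).toEmbedding : Finset ℤ) : Set ℤ) := by
    ext x
    rw [Finset.mem_coe, Finset.mem_map_equiv]
    simp only [leaving, Set.mem_ofPred_eq, Finset.mem_sdiff, hA, Equiv.addRight_symm,
      Equiv.coe_addRight, hB'mem, ← sub_eq_add_neg, sub_add_cancel]
    constructor
    · rintro ⟨hx, hxh⟩
      refine ⟨⟨hx, ?_⟩, fun hc => hxh hc.1⟩
      by_contra hle
      exact hxh (hX.mem_of_le _ (by push_cast at hle; omega))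
    · rintro ⟨⟨hx, hlt⟩, hn⟩
      exact ⟨hx, fun hc => hn ⟨hc, hlt⟩⟩
  rw [h1, h2, Set.ncard_coe_finset, Set.ncard_coe_finset, Finset.card_map]
  have hB'c : B'.card = L := by rw [hB', Finset.card_map, hBc]
  have e1 := Finset.card_sdiff_add_card A B'
  have e2 := Finset.card_sdiff_add_card B' A
  rw [Finset.union_comm] at e2
  omega

/-- The sum of the elements leaving `X` under a shift by `-t` that maps `X` into itself. -/
theorem sum_eq_of_coe_eq_leaving (hX : IsNeutral X L) {t : ℕ} (ht : ∀ x ∈ X, x - t ∈ X)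
    {V : Finset ℤ} (hV : (V : Set ℤ) = leaving X (-t)) :
    2 * ∑ x ∈ V, x = -(t * (t - 1)) := by
  classical
  obtain ⟨A, hAc, hA⟩ := hX.exists_finset (L + t) (by omega)
  obtain ⟨B, hBc, hB⟩ := hX.exists_finset L le_rfl
  set B' := B.map (Equiv.subRight (t : ℤ)).toEmbedding with hB'
  have hB'mem : ∀ x, x ∈ B' ↔ x + t ∈ X ∧ -((L + t : ℕ) : ℤ) < x := by
    intro x
    simp only [hB', Finset.mem_map_equiv, Equiv.subRight_symm_apply, hB]
    push_cast
    constructor <;> rintro ⟨h1, h2⟩ <;> exact ⟨h1, by omega⟩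
  have hsub : B' ⊆ A := by
    intro x hx
    rw [hB'mem] at hx
    exact (hA x).2 ⟨by simpa using ht _ hx.1, hx.2⟩
  have hVA : V = A \ B' := by
    ext x
    rw [← Finset.mem_coe, hV]
    simp only [leaving, Set.mem_ofPred_eq, Finset.mem_sdiff, hA, hB'mem, sub_neg_eq_add]
    constructor
    · rintro ⟨hx, hxh⟩
      refine ⟨⟨hx, ?_⟩, fun hc => hxh hc.1⟩
      by_contra hle
      exact hxh (hX.mem_of_le _ (by push_cast at hle; omega))
    · rintro ⟨⟨hx, hlt⟩, hn⟩
      exact ⟨hx, fun hc => hn ⟨hc, hlt⟩⟩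
  -- Lowering the bound from `-L` to `-(L + t)` adds exactly the `t` integers `-L, …, -L - t + 1`,
  -- so the unknown sum over `B` cancels.
  have hBA : A \ B = (Finset.range t).image fun i : ℕ => -(L : ℤ) - i := by
    ext x
    simp only [Finset.mem_sdiff, hA, hB, Finset.mem_image, Finset.mem_range]
    constructor
    · rintro ⟨⟨hx, h1⟩, h2⟩
      have : ¬ (-(L : ℤ) < x) := fun h => h2 ⟨hx, h⟩
      exact ⟨(-L - x).toNat, by push_cast at h1; omega, by omega⟩
    · rintro ⟨i, hi, rfl⟩
      exact ⟨⟨hX.mem_of_le _ (by omega), by push_cast; omega⟩, fun h => by omega⟩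
  have hBsub : B ⊆ A := fun x hx => by
    rw [hB] at hx
    exact (hA x).2 ⟨hx.1, by push_cast; omega⟩
  have s1 := Finset.sum_sdiff (f := fun x : ℤ => x) hsub
  have s2 := Finset.sum_sdiff (f := fun x : ℤ => x) hBsub
  have s3 : ∑ x ∈ B', x = ∑ x ∈ B, x - L * t := by
    simp [hB', Finset.sum_map, Finset.sum_sub_distrib, hBc]
  have s4 : ∑ x ∈ A \ B, x = -(L * t) - ∑ i ∈ Finset.range t, (i : ℤ) := by
    rw [hBA, Finset.sum_image fun a _ b _ hab => by simpa using hab]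
    simp only [Finset.sum_sub_distrib, Finset.sum_const,
      Finset.card_range, nsmul_eq_mul]
    ring
  have s5 : 2 * ∑ i ∈ Finset.range t, (i : ℤ) = t * (t - 1) := by
    clear * -
    induction t with
    | zero => simp
    | succ n ih => rw [Finset.sum_range_succ, mul_add, ih]; push_cast; ring
  rw [hVA]
  linarith

end IsNeutral

/-! ### Second differences and the hook multiset identity -/

/-- The second difference of the number of leaving elements counts the pairs of extremal elements
with a given difference. -/
theorem ncard_leaving_add_ncard_leaving {X : Set ℤ} {t : ℤ} (ht : ∀ x ∈ X, x - t ∈ X)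
    (hfin : ∀ h, (leaving X h).Finite) (k : ℤ) :
    (leaving X (k - t)).ncard + (leaving X (k + t)).ncard =
      2 * (leaving X k).ncard +
        {y | y ∈ leaving X (-t) ∧ y + k ∈ leaving X (-t)}.ncard := by
  set e : ℤ → Set ℤ := fun k => {y | y ∈ leaving X (-t) ∧ y + k ∈ X} with he
  have hefin : ∀ k, (e k).Finite := fun k => (hfin (-t)).subset fun y hy => hy.1
  -- If `x ∈ X` and `x - k + t ∉ X`, then either `x - k ∉ X`, or `x - k` is extremal.
  have step : ∀ k, (leaving X (k - t)).ncard = (leaving X k).ncard + (e k).ncard := by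
    intro k
    have himg : (e k).ncard = ((fun y => y + k) '' e k).ncard :=
      (Set.ncard_image_of_injective _ (add_left_injective k)).symm
    rw [himg, ← Set.ncard_union_eq ?_ (hfin k) ((hefin k).image _)]
    · congr 1
      ext x
      simp only [leaving, Set.mem_ofPred_eq, Set.mem_union, Set.mem_image, he]
      constructor
      · rintro ⟨hx, hxk⟩
        by_cases h : x - k ∈ X
        · refine Or.inr ⟨x - k, ⟨⟨h, ?_⟩, by simpa using hx⟩, by ring⟩
          convert hxk using 2
          ring
        · exact Or.inl ⟨hx, h⟩
      · rintro (⟨hx, hxk⟩ | ⟨y, ⟨⟨-, hy⟩, hyk⟩, rfl⟩)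
        · refine ⟨hx, fun h => hxk ?_⟩
          convert ht _ h using 1
          ring
        · refine ⟨hyk, ?_⟩
          convert hy using 2
          ring
    · rw [Set.disjoint_left]
      rintro _ hx ⟨y, hy, rfl⟩
      exact hx.2 (by simpa using hy.1.1)
  have step' : (e k).ncard = (e (k + t)).ncard +
      {y | y ∈ leaving X (-t) ∧ y + k ∈ leaving X (-t)}.ncard := by
    rw [← Set.ncard_union_eq ?_ (hefin _) ((hfin (-t)).subset fun y hy => hy.1)]
    · congr 1
      ext y
      simp only [he, leaving, Set.mem_ofPred_eq, Set.mem_union, sub_neg_eq_add]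
      rw [← add_assoc]
      constructor
      · rintro ⟨h1, h2⟩
        by_cases h : y + k + t ∈ X
        · exact Or.inl ⟨h1, h⟩
        · exact Or.inr ⟨h1, h2, h⟩
      · rintro (⟨h1, h2⟩ | ⟨h1, h2⟩)
        · exact ⟨h1, by simpa using ht _ h2⟩
        · exact ⟨h1, h2.1⟩
    · rw [Set.disjoint_left]
      rintro y h1 h2
      exact h2.2.2 (by simpa [← add_assoc] using h1.2)
  have a1 := step k
  have a2 := step (k + t)
  rw [add_sub_cancel_right] at a2
  omega

theorem sub_nat_mul_mem {X : Set ℤ} {t : ℕ} (ht : ∀ x ∈ X, x - t ∈ X) (n : ℕ) {x : ℤ}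
    (hx : x ∈ X) : x - n * t ∈ X := by
  induction n with
  | zero => simpa using hx
  | succ n ih =>
    convert ht _ ih using 1
    push_cast
    ring

/-- An element of `X` is at most any congruent extremal element. -/
theorem le_of_mem_leaving {X : Set ℤ} {t : ℕ} (ht : ∀ x ∈ X, x - t ∈ X) {x y : ℤ}
    (hx : x ∈ leaving X (-t)) (hy : y ∈ X) (hxy : (t : ℤ) ∣ y - x) : y ≤ x := by
  obtain ⟨n, hn⟩ := hxy
  by_contra hlt
  have hn0 : 0 < n := by
    by_contra hle
    have : (t : ℤ) * n ≤ 0 := mul_nonpos_of_nonneg_of_nonpos (by positivity) (not_lt.1 hle)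
    omega
  -- If `y = x + n * t` with `n ≥ 1`, then `n - 1` steps down from `y` reach `x + t`, which is not
  -- in `X`.
  refine hx.2 ?_
  convert sub_nat_mul_mem ht (n - 1).toNat hy using 1
  rw [Int.toNat_of_nonneg (by omega)]
  linear_combination -hn

/-- The condition `0 < k` keeps `h = t` from being counted twice; `k ≤ t` excludes truncated
subtraction. -/
theorem count_map_natAbs_sub (H : Multiset ℕ) (t k : ℕ) :
    (H.map fun h : ℕ => ((h : ℤ) - t).natAbs).count k =
      H.count (t + k) + if 0 < k ∧ k ≤ t then H.count (t - k) else 0 := by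
  induction H using Multiset.induction_on with
  | empty => simp
  | cons a s ih =>
    rw [Multiset.map_cons, Multiset.count_cons, ih, Multiset.count_cons, Multiset.count_cons]
    split_ifs <;> omega

theorem count_map_add (H : Multiset ℕ) (t k : ℕ) :
    (H.map fun h : ℕ => h + t).count k = if t ≤ k then H.count (k - t) else 0 := by
  induction H using Multiset.induction_on with
  | empty => simp
  | cons a s ih =>
    rw [Multiset.map_cons, Multiset.count_cons, ih, Multiset.count_cons]
    split_ifs <;> omega

/-- The hook lengths of a `t`-core and the extremal beta numbers: the combinatorial form. -/
theorem hook_multiset_identity {X : Set ℤ} {L t : ℕ} (hX : IsNeutral X L) (ht0 : 0 < t)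
    (ht : ∀ x ∈ X, x - t ∈ X) {H : Multiset ℕ}
    (hH : ∀ h : ℕ, H.count h = (leaving X h).ncard) {m : Fin t → ℤ} (hm : Function.Injective m)
    (hrange : Set.range m = leaving X (-t)) :
    (H.map fun h : ℕ => ((h : ℤ) - t).natAbs) + (H.map fun h : ℕ => h + t) +
        ∑ k ∈ Finset.Icc 1 (t - 1), Multiset.replicate (t - k) k =
      H + H + (((Finset.univ : Finset (Fin t)).sigma fun i => Finset.Ioi i).val.map
        fun p => (m p.1 - m p.2).natAbs) := by
  classical
  have hzero : (leaving X t).ncard = 0 := by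
    rw [Set.ncard_eq_zero (hX.finite_leaving _)]
    exact Set.eq_empty_of_forall_notMem fun x hx => hx.2 (ht x hx.1)
  have hzero' : (leaving X 0).ncard = 0 := by
    rw [Set.ncard_eq_zero (hX.finite_leaving _)]
    exact Set.eq_empty_of_forall_notMem fun x hx => hx.2 (by simpa using hx.1)
  ext k
  have hpairs : 0 < k →
      (((Finset.univ : Finset (Fin t)).sigma fun i => Finset.Ioi i).val.map
        fun p => (m p.1 - m p.2).natAbs).count k =
      {y | y ∈ leaving X (-t) ∧ y + k ∈ leaving X (-t)}.ncard := by
    intro hk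
    -- An unordered pair of extremal elements at distance `k` is recorded by its smaller member,
    -- whichever index that has.
    have himg : {y | y ∈ leaving X (-t) ∧ y + k ∈ leaving X (-t)} =
        ((((Finset.univ : Finset (Fin t)).sigma fun i => Finset.Ioi i).filter
          fun p => k = (m p.1 - m p.2).natAbs).image fun p => min (m p.1) (m p.2) :
            Finset ℤ) := by
      ext y
      simp only [Set.mem_ofPred_eq, ← hrange, Set.mem_range, Finset.coe_image, Finset.coe_filter,
        Set.mem_image, Finset.mem_sigma, Finset.mem_univ, true_and, Finset.mem_Ioi, Sigma.exists]
      constructor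
      · rintro ⟨⟨i, hi⟩, j, hj⟩
        rcases lt_trichotomy i j with h | h | h
        · exact ⟨i, j, ⟨h, by omega⟩, by omega⟩
        · subst h
          omega
        · exact ⟨j, i, ⟨h, by omega⟩, by omega⟩
      · rintro ⟨i, j, ⟨h, hk'⟩, hy⟩
        rcases le_total (m i) (m j) with hle | hle
        · exact ⟨⟨i, by omega⟩, j, by omega⟩
        · exact ⟨⟨j, by omega⟩, i, by omega⟩
    rw [himg, Set.ncard_coe_finset, Finset.card_image_of_injOn, Multiset.count_map]
    · rfl
    · rintro ⟨i, j⟩ hp ⟨i', j'⟩ hq heq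
      simp only [Finset.coe_filter, Set.mem_ofPred_eq, Finset.mem_sigma, Finset.mem_univ,
        true_and, Finset.mem_Ioi] at hp hq heq
      have hcases : (m i = m i' ∧ m j = m j') ∨ (m i = m j' ∧ m j = m i') := by omega
      rcases hcases with ⟨h1, h2⟩ | ⟨h1, h2⟩
      · rw [hm h1, hm h2]
      · exact absurd (hm h1 ▸ hm h2 ▸ hp.1) hq.1.not_gt
  have hsum : (∑ k ∈ Finset.Icc 1 (t - 1), Multiset.replicate (t - k) k).count k =
      if 0 < k ∧ k < t then t - k else 0 := by
    rw [Multiset.count_sum']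
    simp only [Multiset.count_replicate]
    rw [Finset.sum_ite_eq']
    simp only [Finset.mem_Icc]
    split_ifs <;> omega
  have hsecond := ncard_leaving_add_ncard_leaving ht hX.finite_leaving k
  simp only [Multiset.count_add, count_map_natAbs_sub, count_map_add, hsum, hH]
  rcases Nat.eq_zero_or_pos k with rfl | hk
  · have h0 : (((Finset.univ : Finset (Fin t)).sigma fun i => Finset.Ioi i).val.map
        fun p => (m p.1 - m p.2).natAbs).count 0 = 0 := by
      rw [Multiset.count_eq_zero, Multiset.mem_map]
      rintro ⟨⟨i, j⟩, hp, hij⟩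
      have hlt : i < j := by simpa using hp
      have hij' : (m i - m j).natAbs = 0 := hij
      exact hlt.ne (hm (by omega))
    simp [h0, hzero, hzero', ht0.ne']
  · rw [hpairs hk]
    rcases lt_trichotomy k t with hkt | rfl | hkt
    · have hneg := hX.ncard_leaving_neg (t - k)
      rw [Nat.cast_sub hkt.le, neg_sub] at hneg
      rw [if_pos ⟨hk, hkt.le⟩, if_neg (by omega), if_pos ⟨hk, hkt⟩, Nat.cast_sub hkt.le]
      rw [add_comm (k : ℤ) t] at hsecond
      push_cast
      omega
    · simp only [sub_self, hzero'] at hsecond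
      simp only [le_refl, and_true, hk, if_true, Nat.sub_self, Nat.cast_zero, hzero', lt_irrefl,
        and_false, if_false, Nat.cast_add]
      omega
    · rw [if_neg (by omega), if_pos hkt.le, if_neg (by omega), Nat.cast_sub hkt.le]
      rw [add_comm (k : ℤ) t] at hsecond
      push_cast
      omega

/-- The hook lengths of a `t`-core and the extremal beta numbers: the multiplicative form for
functions of the absolute value. -/
theorem hook_prod_identity {X : Set ℤ} {L t : ℕ} (hX : IsNeutral X L) (ht0 : 0 < t)
    (ht : ∀ x ∈ X, x - t ∈ X) {H : Multiset ℕ}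
    (hH : ∀ h : ℕ, H.count h = (leaving X h).ncard) {m : Fin t → ℤ} (hm : Function.Injective m)
    (hrange : Set.range m = leaving X (-t)) {M : Type*} [CommMonoid M] (g : ℕ → M) :
    (H.map fun h : ℕ => g ((h : ℤ) - t).natAbs).prod * (H.map fun h : ℕ => g (h + t)).prod *
        ∏ k ∈ Finset.Icc 1 (t - 1), g k ^ (t - k) =
      (H.map g).prod ^ 2 * ∏ i : Fin t, ∏ j ∈ Finset.Ioi i, g (m i - m j).natAbs := by
  have key := congrArg (fun s => (s.map g).prod)
    (hook_multiset_identity hX ht0 ht hH hm hrange)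
  simp only [Multiset.map_add, Multiset.prod_add, Multiset.map_map, Function.comp_def] at key
  rw [sq, Finset.prod_sigma']
  convert key using 2
  · rw [← Multiset.coe_mapAddMonoidHom, map_sum, Multiset.prod_sum]
    simp
  · rfl

/-! ### Extremal elements by residue class -/

/-- Representatives of the extremal elements indexed by residue classes. -/
theorem exists_residue_enumeration {X : Set ℤ} {L t : ℕ} (hX : IsNeutral X L) (ht0 : 0 < t)
    (ht : ∀ x ∈ X, x - t ∈ X) (c : ℤ) :
    ∃ m : Fin t → ℤ, Function.Injective m ∧ Set.range m = leaving X (-t) ∧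
      (∀ i, (t : ℤ) ∣ m i + c - (i : ℕ)) ∧ 2 * ∑ i, m i = -(t * (t - 1)) := by
  classical
  have hfin := hX.finite_leaving (-t)
  -- Here `N(t) = 0`, so `N(-t) = t`: as many extremal elements as classes, and injectivity of the
  -- residue map suffices.
  have hcard : (leaving X (-t)).ncard = t := by
    rw [hX.ncard_leaving_neg, Nat.add_eq_right, Set.ncard_eq_zero (hX.finite_leaving _)]
    exact Set.eq_empty_of_forall_notMem fun x hx => hx.2 (ht x hx.1)
  have ht0' : (0 : ℤ) < t := by exact_mod_cast ht0
  let f : hfin.toFinset → Fin t := fun x =>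
    ⟨((x.1 + c) % t).toNat, by
      have := Int.emod_nonneg (x.1 + c) ht0'.ne'
      have := Int.emod_lt_of_pos (x.1 + c) ht0'
      omega⟩
  have hf : ∀ x, (t : ℤ) ∣ x.1 + c - (f x : ℕ) := by
    intro x
    have := Int.emod_nonneg (x.1 + c) ht0'.ne'
    simp only [f, Int.toNat_of_nonneg this]
    exact Int.dvd_self_sub_emod
  have hinj : Function.Injective f := by
    intro x y hxy
    have hx := hf x
    have hy := hf y
    rw [hxy] at hx
    have hd : (t : ℤ) ∣ x.1 - y.1 := by
      have := dvd_sub hx hy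
      rwa [sub_sub_sub_cancel_right, add_sub_add_right_eq_sub] at this
    have hxm := hfin.mem_toFinset.1 x.2
    have hym := hfin.mem_toFinset.1 y.2
    exact Subtype.ext (le_antisymm (le_of_mem_leaving ht hym hxm.1 hd)
      (le_of_mem_leaving ht hxm hym.1 (by rwa [← neg_sub, dvd_neg])))
  have hbij : Function.Bijective f := by
    rw [Fintype.bijective_iff_injective_and_card]
    refine ⟨hinj, ?_⟩
    rw [Fintype.card_coe, Fintype.card_fin, ← Set.ncard_eq_toFinset_card _ hfin, hcard]
  let e := Equiv.ofBijective f hbij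
  have hrange : Set.range (fun i => (e.symm i).1) = leaving X (-t) := by
    ext x
    constructor
    · rintro ⟨i, rfl⟩
      exact hfin.mem_toFinset.1 (e.symm i).2
    · intro hx
      exact ⟨e ⟨x, hfin.mem_toFinset.2 hx⟩, by simp⟩
  refine ⟨fun i => (e.symm i).1, Subtype.val_injective.comp e.symm.injective, hrange,
    fun i => ?_, ?_⟩
  · have := hf (e.symm i)
    rwa [show f (e.symm i) = i from e.apply_symm_apply i] at this
  · rw [e.symm.sum_comp (fun x => x.1), Finset.sum_coe_sort hfin.toFinset (fun x => x)]
    exact hX.sum_eq_of_coe_eq_leaving ht hfin.coe_toFinset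

/-! ### The sign for odd functions -/

/-- The sign of an integer as a unit, with `0` counted as positive. -/
def unitSign (x : ℤ) : ℤˣ := if x < 0 then -1 else 1

/-- For `x` not divisible by `t`, `⌊-x/t⌋ = -⌊x/t⌋ - 1`, so passing to `|x|` flips the parity
exactly when `x < 0`. -/
theorem negOnePow_natAbs_div {t : ℕ} (ht0 : 0 < t) {x : ℤ} (hx : ¬ (t : ℤ) ∣ x) :
    Int.negOnePow ((x.natAbs / t : ℕ) : ℤ) = unitSign x * Int.negOnePow (x / t) := by
  have ht0' : (0 : ℤ) < t := by exact_mod_cast ht0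
  unfold unitSign
  split_ifs with h
  · have hneg : (-x) / (t : ℤ) = -(x / t) - 1 := by
      have h1 := Int.mul_ediv_add_emod x t
      have h2 := Int.emod_lt_of_pos x ht0'
      have h3 := Int.emod_pos_of_not_dvd hx
      refine Int.ediv_eq_iff_of_pos ht0' |>.2 ⟨?_, ?_⟩ <;>
        nlinarith [h3.resolve_left ht0'.ne']
    rw [Int.natCast_div, Int.natCast_natAbs, abs_of_neg h, hneg, Int.negOnePow_sub,
      Int.negOnePow_neg, Int.negOnePow_one, mul_comm]
  · rw [Int.natCast_div, Int.natCast_natAbs, abs_of_nonneg (not_lt.1 h), one_mul]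

theorem negOnePow_pow_mul_eq {t n : ℕ} (ht0 : 0 < t) (hn : 2 * n = t * (t - 1)) {q : ℤ}
    (hq : q = ((t - 1) / 2 : ℕ) - ((t : ℤ) - 1)) :
    Int.negOnePow q ^ (t - 1) * (-1) ^ n = if t % 4 = 3 then -1 else 1 := by
  obtain ⟨s, hs⟩ : ∃ s, t = 4 * s + t % 4 := ⟨t / 4, by omega⟩
  have hr : t % 4 < 4 := Nat.mod_lt _ (by norm_num)
  generalize t % 4 = r at hs hr
  subst hs
  interval_cases r
  · have hqe : Even q := ⟨-s, by omega⟩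
    have hne : Even n := ⟨s * (4 * s - 1), by
      have : 4 * s * (4 * s - 1) = 4 * (s * (4 * s - 1)) := by ring
      simp only [add_zero] at hn
      omega⟩
    rw [Int.negOnePow_even _ hqe, hne.neg_one_pow]
    simp
  · have hne : Even n := ⟨s * (4 * s + 1), by
      have : (4 * s + 1) * (4 * s + 1 - 1) = 4 * (s * (4 * s + 1)) := by
        rw [Nat.add_sub_cancel]; ring
      omega⟩
    rw [hne.neg_one_pow, show 4 * s + 1 - 1 = 2 * (2 * s) by omega, pow_mul, Int.units_sq,
      one_pow, if_neg (by omega), one_mul]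
  · have hqo : Odd q := ⟨-s - 1, by omega⟩
    have hno : Odd n := ⟨s * (4 * s + 3), by
      have : (4 * s + 2) * (4 * s + 2 - 1) = 4 * (s * (4 * s + 3)) + 2 := by
        rw [show 4 * s + 2 - 1 = 4 * s + 1 by omega]; ring
      omega⟩
    have hto : Odd (4 * s + 2 - 1) := ⟨2 * s, by omega⟩
    rw [Int.negOnePow_odd _ hqo, hno.neg_one_pow, hto.neg_one_pow, if_neg (by omega)]
    rfl
  · have hno : Odd n := ⟨s * (4 * s + 5) + 1, by
      have : (4 * s + 3) * (4 * s + 3 - 1) = 4 * (s * (4 * s + 5)) + 6 := by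
        rw [show 4 * s + 3 - 1 = 4 * s + 2 by omega]; ring
      omega⟩
    rw [hno.neg_one_pow, show 4 * s + 3 - 1 = 2 * (2 * s + 1) by omega, pow_mul, Int.units_sq,
      one_pow, if_pos (by omega), one_mul]

theorem negOnePow_sum {ι : Type*} (s : Finset ι) (q : ι → ℤ) :
    Int.negOnePow (∑ i ∈ s, q i) = ∏ i ∈ s, Int.negOnePow (q i) := by
  induction s using Finset.cons_induction with
  | empty => simp
  | cons a s ha ih => rw [Finset.sum_cons, Finset.prod_cons, Int.negOnePow_add, ih]

/-- The total sign picked up when all arguments are replaced by their absolute values. -/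
theorem prod_unitSign_mul_prod_unitSign {X : Set ℤ} {L t : ℕ} (hX : IsNeutral X L) (ht0 : 0 < t)
    (ht : ∀ x ∈ X, x - t ∈ X) {H : Multiset ℕ}
    (hH : ∀ h : ℕ, H.count h = (leaving X h).ncard) (hcore : ∀ h ∈ H, ¬ t ∣ h)
    {m : Fin t → ℤ} (hm : Function.Injective m) (hrange : Set.range m = leaving X (-t))
    (hres : ∀ i, (t : ℤ) ∣ m i + ((t - 1) / 2 : ℕ) - (i : ℕ))
    (hsum : 2 * ∑ i, m i = -(t * (t - 1))) :
    (H.map fun h : ℕ => unitSign (h - t)).prod *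
        ∏ i : Fin t, ∏ j ∈ Finset.Ioi i, unitSign (m i - m j) =
      if t % 4 = 3 then -1 else 1 := by
  have ht0' : (0 : ℤ) < t := by exact_mod_cast ht0
  have key := hook_prod_identity hX ht0 ht hH hm hrange
    (fun k => Int.negOnePow ((k / t : ℕ) : ℤ))
  have hone : ∏ k ∈ Finset.Icc 1 (t - 1), Int.negOnePow ((k / t : ℕ) : ℤ) ^ (t - k) = 1 := by
    refine Finset.prod_eq_one fun k hk => ?_
    rw [Finset.mem_Icc] at hk
    rw [Nat.div_eq_of_lt (by omega)]
    simp
  -- The floors of `(h - t)/t` and `(h + t)/t` differ by `2`, so only the sign of `h - t` survives.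
  have hhooks : (H.map fun h : ℕ => Int.negOnePow ((((h : ℤ) - t).natAbs / t : ℕ) : ℤ)).prod *
      (H.map fun h : ℕ => Int.negOnePow (((h + t) / t : ℕ) : ℤ)).prod =
      (H.map fun h : ℕ => unitSign (h - t)).prod := by
    rw [← Multiset.prod_map_mul]
    refine congrArg Multiset.prod (Multiset.map_congr rfl fun h hh => ?_)
    have hd : ¬ (t : ℤ) ∣ (h : ℤ) - t := by
      rw [dvd_sub_self_right]
      exact_mod_cast hcore h hh
    rw [negOnePow_natAbs_div ht0 hd, Nat.add_div_right _ ht0, mul_assoc, ← Int.negOnePow_add,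
      show ((h : ℤ) - t) / t = h / t - 1 by
        simpa [sub_eq_add_neg] using Int.add_mul_ediv_right (h : ℤ) (-1) ht0'.ne',
      Int.negOnePow_even, mul_one]
    exact ⟨h / t, by push_cast; ring⟩
  choose q hq using hres
  have hdiff : ∀ i, ∀ j ∈ Finset.Ioi i,
      Int.negOnePow (((m i - m j).natAbs / t : ℕ) : ℤ) =
        unitSign (m i - m j) * ((Int.negOnePow (q i) * Int.negOnePow (q j)) * -1) := by
    intro i j hij
    rw [Finset.mem_Ioi] at hij
    have hij' : (i : ℕ) < j := hij
    have hjt := j.2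
    -- For `i < j` the remainder `t + i - j` lies strictly between `0` and `t`, so the floor of the
    -- quotient is `q i - q j - 1`.
    have hmm : m i - m j = (t + i - j : ℤ) + (q i - q j - 1) * t := by
      linear_combination hq i - hq j
    have hd : ¬ (t : ℤ) ∣ m i - m j := by
      rw [hmm, dvd_add_left (Dvd.intro_left _ rfl)]
      exact fun h => absurd (Int.le_of_dvd (by omega) h) (by omega)
    rw [negOnePow_natAbs_div ht0 hd]
    congr 1
    rw [hmm, Int.add_mul_ediv_right _ _ ht0'.ne', Int.ediv_eq_zero_of_lt (by omega) (by omega),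
      zero_add, Int.negOnePow_sub, Int.negOnePow_sub, Int.negOnePow_one]
  -- Each index lies in `t - 1` pairs.
  have hpairs : ∏ i : Fin t, ∏ j ∈ Finset.Ioi i,
      ((Int.negOnePow (q i) * Int.negOnePow (q j)) * -1) =
      Int.negOnePow (∑ i, q i) ^ (t - 1) * (-1) ^ ∑ i : Fin t, (Finset.Ioi i).card := by
    have hoff := Finset.prod_prod_Ioi_mul_eq_prod_prod_off_diag
      (fun _ i : Fin t => Int.negOnePow (q i))
    simp only [Finset.prod_const, Finset.card_compl, Finset.card_singleton, Fintype.card_fin,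
      Finset.prod_pow] at hoff
    rw [negOnePow_sum, ← hoff, ← Finset.prod_pow_eq_pow_sum, ← Finset.prod_mul_distrib]
    refine Finset.prod_congr rfl fun i _ => ?_
    rw [Finset.prod_mul_distrib, Finset.prod_const]
  have hcount : 2 * ∑ i : Fin t, (Finset.Ioi i).card = t * (t - 1) := by
    have hoff := Finset.sum_sum_Ioi_add_eq_sum_sum_off_diag (fun _ _ : Fin t => 1)
    simp only [Finset.sum_const, smul_eq_mul, Finset.card_compl, Finset.card_singleton,
      Fintype.card_fin, Finset.card_univ, mul_one] at hoff
    rw [← hoff, Finset.mul_sum]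
    exact Finset.sum_congr rfl fun i _ => mul_comm _ _
  -- Summing `m i + ⌊(t-1)/2⌋ - i = t * q i` over `i` and using the known sum of the `m i`
  -- determines the sum of the `q i`.
  have hqsum : ∑ i, q i = ((t - 1) / 2 : ℕ) - ((t : ℤ) - 1) := by
    have h1 : ∑ i : Fin t, (m i + ((t - 1) / 2 : ℕ) - (i : ℕ)) = ∑ i, t * q i :=
      Finset.sum_congr rfl fun i _ => hq i
    have h2 : 2 * ∑ i : Fin t, ((i : ℕ) : ℤ) = t * (t - 1) := by
      rw [Fin.sum_univ_eq_sum_range (fun i : ℕ => (i : ℤ)) t]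
      have := Finset.sum_range_id_mul_two t
      have h3 : ((∑ i ∈ Finset.range t, i) * 2 : ℤ) = (t * (t - 1 : ℕ) : ℕ) := by
        rw [← this]; push_cast; rfl
      push_cast [Nat.cast_sub ht0] at h3
      linarith
    rw [Finset.sum_sub_distrib, Finset.sum_add_distrib, ← Finset.mul_sum, Finset.sum_const,
      Finset.card_univ, Fintype.card_fin, nsmul_eq_mul] at h1
    refine mul_left_cancel₀ ht0'.ne' ?_
    linarith
  rw [hone, hhooks, mul_one, Int.units_sq, one_mul,
    Finset.prod_congr rfl fun i _ => Finset.prod_congr rfl (hdiff i)] at key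
  simp_rw [Finset.prod_mul_distrib (f := fun j => unitSign _)] at key
  rw [Finset.prod_mul_distrib, hpairs] at key
  rw [key, mul_right_comm, ← sq, Int.units_sq, one_mul]
  exact negOnePow_pow_mul_eq ht0 hcount hqsum

/-! ### The quotient formula with signs -/

/-- The hook quotient product for a function that agrees up to the signs `s` with its values at
absolute values. -/
theorem hook_quotient_prod {X : Set ℤ} {L t : ℕ} (hX : IsNeutral X L) (ht0 : 0 < t)
    (ht : ∀ x ∈ X, x - t ∈ X) {H : Multiset ℕ}
    (hH : ∀ h : ℕ, H.count h = (leaving X h).ncard) {m : Fin t → ℤ} (hm : Function.Injective m)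
    (hrange : Set.range m = leaving X (-t)) {F : Type*} [Field F] {τ : ℤ → F} {s : ℤ → ℤˣ}
    (hs : ∀ k, τ k = ((s k : ℤ) : F) * τ k.natAbs) (hτH : ∀ h ∈ H, τ (h : ℤ) ≠ 0)
    (hτ : ∀ k ∈ Finset.Icc 1 (t - 1), τ (k : ℤ) ≠ 0) :
    (H.map fun h : ℕ => τ ((h : ℤ) - t) * τ ((h : ℤ) + t) / τ (h : ℤ) ^ 2).prod =
      ((((H.map fun h : ℕ => s (h - t)).prod *
        ∏ i : Fin t, ∏ j ∈ Finset.Ioi i, s (m i - m j) : ℤˣ) : ℤ) : F) /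
          (∏ k ∈ Finset.Icc 1 (t - 1), τ (k : ℤ) ^ (t - k)) *
        ∏ i : Fin t, ∏ j ∈ Finset.Ioi i, τ (m i - m j) := by
  let φ : ℤˣ →* F := (Int.castRingHom F : ℤ →* F).comp (Units.coeHom ℤ)
  have hφ : ∀ u : ℤˣ, ((u : ℤ) : F) = φ u := fun _ => rfl
  simp only [hφ] at hs ⊢
  have key := hook_prod_identity hX ht0 ht hH hm hrange (fun k => τ (k : ℤ))
  have hA : (H.map fun h : ℕ => τ ((h : ℤ) - t)).prod =
      φ (H.map fun h : ℕ => s (h - t)).prod *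
        (H.map fun h : ℕ => τ (((h : ℤ) - t).natAbs : ℤ)).prod := by
    rw [map_multiset_prod, Multiset.map_map, ← Multiset.prod_map_mul]
    exact congrArg Multiset.prod (Multiset.map_congr rfl fun h _ => hs _)
  have hP : ∏ i : Fin t, ∏ j ∈ Finset.Ioi i, τ (m i - m j) =
      φ (∏ i : Fin t, ∏ j ∈ Finset.Ioi i, s (m i - m j)) *
        ∏ i : Fin t, ∏ j ∈ Finset.Ioi i, τ ((m i - m j).natAbs : ℤ) := by
    simp_rw [map_prod, ← Finset.prod_mul_distrib, ← hs]
  have hQ : (H.map fun h : ℕ => τ (h : ℤ)).prod ≠ 0 := by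
    rw [Ne, Multiset.prod_eq_zero_iff, Multiset.mem_map]
    rintro ⟨h, hh, h0⟩
    exact hτH h hh h0
  have hD : ∏ k ∈ Finset.Icc 1 (t - 1), τ (k : ℤ) ^ (t - k) ≠ 0 :=
    Finset.prod_ne_zero_iff.2 fun k hk => pow_ne_zero _ (hτ k hk)
  have hsq : φ (∏ i : Fin t, ∏ j ∈ Finset.Ioi i, s (m i - m j)) ^ 2 = 1 := by
    rw [← map_pow, Int.units_sq, map_one]
  rw [Multiset.prod_map_div, Multiset.prod_map_mul, Multiset.prod_map_pow, hA, hP, map_mul]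
  simp only [Nat.cast_add] at key
  rw [div_mul_eq_mul_div, div_eq_div_iff (pow_ne_zero _ hQ) hD]
  linear_combination φ (H.map fun h : ℕ => s (h - t)).prod * key -
    φ (H.map fun h : ℕ => s (h - t)).prod * (H.map fun h : ℕ => τ (h : ℤ)).prod ^ 2 *
      (∏ i : Fin t, ∏ j ∈ Finset.Ioi i, τ ((m i - m j).natAbs : ℤ)) * hsq

/-! ### Translation to the `W`-set and the `V`-set -/

theorem cast_add_modEq_cast_add_iff (t : ℕ) (r : ℚ) (a b : ℤ) :
    (a : ℚ) + r ≡ b + r [PMOD (t : ℚ)] ↔ (t : ℤ) ∣ b - a := by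
  rw [AddCommGroup.modEq_iff_eq_add_zsmul]
  refine exists_congr fun z => ?_
  rw [zsmul_eq_mul, ← Int.cast_inj (α := ℚ)]
  push_cast
  constructor <;> intro h <;> linarith

theorem half_add_shift {t : ℕ} (ht0 : 0 < t) :
    (((t - 1) / 2 : ℕ) : ℚ) + shift t = ((t : ℚ) - 1) / 2 := by
  unfold shift
  split_ifs with h
  · obtain ⟨k, rfl⟩ := h
    rw [show (2 * k + 1 - 1) / 2 = k by omega]
    push_cast
    ring
  · obtain ⟨k, rfl⟩ := Nat.not_odd_iff_even.1 h
    obtain ⟨n, rfl⟩ : ∃ n, k = n + 1 := ⟨k - 1, by omega⟩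
    rw [show (n + 1 + (n + 1) - 1) / 2 = n by omega]
    push_cast
    ring

/-- The affine map that takes the normalised beta numbers to the `W`-set. -/
def toWSet (t : ℕ) (z : ℤ) : ℚ := ((z + ((t - 1) / 2 : ℕ) : ℤ) : ℚ) + shift t

theorem toWSet_strictMono (t : ℕ) : StrictMono (toWSet t) := by
  intro a b hab
  have : (a : ℚ) < b := by exact_mod_cast hab
  unfold toWSet
  push_cast
  linarith

theorem toWSet_modEq_iff (t : ℕ) (a b : ℤ) :
    toWSet t a ≡ toWSet t b [PMOD (t : ℚ)] ↔ (t : ℤ) ∣ b - a := by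
  unfold toWSet
  rw [cast_add_modEq_cast_add_iff, add_sub_add_right_eq_sub]

theorem wSet_eq_image {t : ℕ} (ht0 : 0 < t) (μ : YoungDiagram) :
    wSet t μ = toWSet t '' betaSet μ := by
  have hc := half_add_shift ht0
  ext x
  simp only [wSet, betaSet, Set.mem_ofPred_eq, Set.mem_image, Set.exists_range_iff]
  refine exists_congr fun n => ?_
  rw [eq_comm]
  refine Eq.congr ?_ rfl
  unfold toWSet beta
  simp only [Int.cast_add, Int.cast_sub, Int.cast_natCast]
  linarith

theorem vSet_eq_image {t : ℕ} (ht0 : 0 < t) (μ : YoungDiagram)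
    (ht : ∀ x ∈ betaSet μ, x - t ∈ betaSet μ) :
    vSet t μ = toWSet t '' leaving (betaSet μ) (-t) := by
  ext x
  simp only [vSet, wSet_eq_image ht0, Set.mem_ofPred_eq, Set.forall_mem_image]
  constructor
  · rintro ⟨⟨z, hz, rfl⟩, hmax⟩
    refine ⟨z, ⟨hz, fun hz' => ?_⟩, rfl⟩
    rw [sub_neg_eq_add] at hz'
    have := (toWSet_strictMono t).le_iff_le.1
      (hmax hz' ((toWSet_modEq_iff t _ _).2 ⟨-1, by ring⟩))
    omega
  · rintro ⟨z, hz, rfl⟩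
    refine ⟨⟨z, hz.1, rfl⟩, fun w hw hwz => (toWSet_strictMono t).monotone ?_⟩
    refine le_of_mem_leaving ht hz hw ?_
    rw [← neg_sub, dvd_neg]
    exact (toWSet_modEq_iff t _ _).1 hwz

theorem IsCore.not_dvd {t : ℕ} {μ : YoungDiagram} (hμ : IsCore t μ) :
    ∀ h ∈ hookLengths μ, ¬ t ∣ h :=
  Multiset.filter_eq_nil.1 hμ

/-- An `x ∈ X` with `x - t ∉ X` would produce a hook of length `t`. -/
theorem IsCore.sub_mem_betaSet {t : ℕ} {μ : YoungDiagram} (hμ : IsCore t μ) :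
    ∀ x ∈ betaSet μ, x - t ∈ betaSet μ := by
  intro x hx
  by_contra hxt
  refine hμ.not_dvd t ?_ dvd_rfl
  rw [← Multiset.count_pos, count_hookLengths,
    Set.ncard_pos ((isNeutral_betaSet μ).finite_leaving _)]
  exact ⟨x, hx, hxt⟩

end HookCoding

/-! ### The corollary -/

theorem corollary3p1 (t : ℕ) (ht : 0 < t) (μ : YoungDiagram) (hμ : HookCoding.IsCore t μ) :
    ∃ v u : Fin t → ℚ, HookCoding.IsCodingOf t μ v ∧ HookCoding.IsResidueSorting t v u ∧
      ∀ (F : Type*) [Field F] (τ : ℤ → F), Function.Even τ ∨ Function.Odd τ →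
        (∀ h ∈ HookCoding.hookLengths μ, τ (h : ℤ) ≠ 0) →
        (∀ k ∈ Finset.Icc 1 (t - 1), τ (k : ℤ) ≠ 0) →
        ((HookCoding.hookLengths μ).map fun h : ℕ =>
            τ ((h : ℤ) - (t : ℤ)) * τ ((h : ℤ) + (t : ℤ)) / τ (h : ℤ) ^ 2).prod =
          HookCoding.signConstant t τ / (∏ k ∈ Finset.Icc 1 (t - 1), τ (k : ℤ) ^ (t - k)) *
            ∏ i : Fin t, ∏ j ∈ Finset.Ioi i, τ ⌊u i - u j⌋ := by
  have hX := HookCoding.isNeutral_betaSet μ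
  have hclosed := hμ.sub_mem_betaSet
  obtain ⟨m, hm, hrange, hres, hsum⟩ :=
    HookCoding.exists_residue_enumeration hX ht hclosed ((t - 1) / 2 : ℕ)
  -- Sorting is increasing; the reversal makes the coding decreasing.
  let π : Equiv.Perm (Fin t) := Fin.revPerm.trans (Tuple.sort m)
  have hmod : ∀ i : Fin t, HookCoding.toWSet t (m i) ≡
      ((i : ℕ) : ℚ) + HookCoding.shift t [PMOD (t : ℚ)] := by
    intro i
    have := (HookCoding.cast_add_modEq_cast_add_iff t (HookCoding.shift t)
      (m i + ((t - 1) / 2 : ℕ)) (i : ℕ)).2 (by rw [← neg_sub, dvd_neg]; exact hres i)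
    rwa [Int.cast_natCast] at this
  refine ⟨fun i => HookCoding.toWSet t (m (π i)), fun i => HookCoding.toWSet t (m i),
    ⟨⟨fun i => ⟨m (π i) + ((t - 1) / 2 : ℕ), add_comm _ _⟩, fun r => ⟨π.symm r, ?_⟩, ?_, ?_⟩, ?_⟩,
    ⟨⟨π.symm, fun i => by simp only [π.apply_symm_apply]⟩, hmod⟩, ?_⟩
  · rw [π.apply_symm_apply]
    exact hmod r
  · rw [Equiv.sum_comp π fun i => HookCoding.toWSet t (m i)]
    have hc := HookCoding.half_add_shift ht
    have hsum' : 2 * ∑ i, (m i : ℚ) = -(t * (t - 1)) := by exact_mod_cast hsum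
    simp only [HookCoding.toWSet, Int.cast_add, Int.cast_natCast, add_assoc, hc,
      Finset.sum_add_distrib, Finset.sum_const, Finset.card_univ, Fintype.card_fin, nsmul_eq_mul]
    linarith
  · have hsort : StrictMono (m ∘ Tuple.sort m) :=
      (Tuple.monotone_sort m).strictMono_of_injective (hm.comp (Tuple.sort m).injective)
    exact (HookCoding.toWSet_strictMono t).comp_strictAnti
      (hsort.comp_strictAnti Fin.rev_strictAnti)
  · rw [HookCoding.vSet_eq_image ht μ hclosed, ← hrange, ← Set.range_comp]
    exact π.surjective.range_comp (HookCoding.toWSet t ∘ m)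
  · intro F _ τ hτ hτH hτk
    have hfloor : ∀ i j, ⌊HookCoding.toWSet t (m i) - HookCoding.toWSet t (m j)⌋ = m i - m j := by
      intro i j
      rw [HookCoding.toWSet, HookCoding.toWSet, add_sub_add_right_eq_sub, ← Int.cast_sub,
        Int.floor_intCast, add_sub_add_right_eq_sub]
    simp only [hfloor]
    -- In characteristic `2` a function can be both even and odd; splitting on oddness matches
    -- `signConstant`.
    by_cases hodd : Function.Odd τ
    · have hs : ∀ k, τ k = ((HookCoding.unitSign k : ℤ) : F) * τ k.natAbs := by
        intro k
        unfold HookCoding.unitSign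
        split_ifs with hk
        · rw [Int.ofNat_natAbs_of_nonpos hk.le, hodd k]
          simp
        · rw [Int.natAbs_of_nonneg (not_lt.1 hk)]
          simp
      rw [HookCoding.hook_quotient_prod hX ht hclosed (HookCoding.count_hookLengths μ) hm hrange
        hs hτH hτk, HookCoding.prod_unitSign_mul_prod_unitSign hX ht hclosed
        (HookCoding.count_hookLengths μ) hμ.not_dvd hm hrange hres hsum]
      congr 2
      simp only [HookCoding.signConstant, hodd, and_true]
      split_ifs <;> simp
    · have hs : ∀ k, τ k = (((fun _ => 1 : ℤ → ℤˣ) k : ℤ) : F) * τ k.natAbs := by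
        intro k
        rcases Int.natAbs_eq k with h | h
        · rw [← h]; simp
        · nth_rewrite 1 [h]
          rw [hτ.resolve_right hodd]
          simp
      rw [HookCoding.hook_quotient_prod hX ht hclosed (HookCoding.count_hookLengths μ) hm hrange
        hs hτH hτk]
      simp [HookCoding.signConstant, hodd]
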